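/- Let $\mu,\psi\in\mathbb{R}^2$ be nonzero with $\mu\perp\psi$, and let $\sigma>0$. In the four-Gaussian mixture model, a point with label $y\in\{-1,1\}$ and protected attribute $a\in\{-1,1\}$ has features $x\mid(y,a)\sim\mathcal N(y\mu+ya\psi,\sigma^2 I_2)$; $a=1$ is the majority and $a=-1$ the minority. All samples are independent. At stage $k$ the training set consists of the first $p_y(k)$ majority samples and the first $m_y(k)$ minority samples with label $y$, for each $y=\pm1$. Assume that $p_y(k)\to\infty$ for both $y$, that the ratios $p_{1}(k)/p_{-1}(k)$ stay bounded away from $0$ and $\infty$ for large $k$, and that the majority is much larger than the minority in the sense that for all $y,y'\in\{-1,1\}$ $$\liminf_{k\to\infty}\Big(\sigma\sqrt{2\log p_y(k)}-\sigma\sqrt{2\log m_{y'}(k)}\Big)\ \ge\ 2\max(\|\mu\|,\|\psi\|)$$ (with $\sqrt{2\log 0}:=0$; this holds for instance if the $m_{y}(k)$ are bounded). Before training, the labels of the minority training points may be replaced by arbitrary labels in $\{-1,1\}$, which may depend on the whole sample and on $k$; the majority labels are kept. An SVM solution for a labelled sample $(x_i,\ell_i)$ is a pair $(w,b)$ with $\|w\|=1$,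 $b\in\mathbb{R}$ that maximizes the margin $\min_i \ell_i(\langle w,x_i\rangle+b)$ over all such pairs (the margin may be negative). For the classifier $h$ predicting $1$ iff $\langle w,x\rangle+b>0$, the equalized-odds violation is $$\mathrm{EqOd}_\sigma(w,b)=\tfrac12\sum_{z=\pm1}\big|P[h(x)=1\mid a=1,y=z]-P[h(x)=1\mid a=-1,y=z]\big|.$$ Put $w_{\mathrm{spu}}=(\mu+\psi)/\|\mu+\psi\|$. 1. With probability one, simultaneously for every relabeling of the minority: an SVM solution exists for all large $k$, and any choice $(w_k,b_k)$ of SVM solutions satisfies $w_k\to w_{\mathrm{spu}}$, $b_k\to0$ and $\mathrm{EqOd}_\sigma(w_k,b_k)\to\mathrm{EqOd}_\sigma(w_{\mathrm{spu}},0)$ as $k\to\infty$. 2. If $\|\mu\|=\|\psi\|$, then the violation of the limiting classifier tends to its well-separated limit $0.5$: $\mathrm{EqOd}_s(w_{\mathrm{spu}},0)\to\tfrac12$ as the noise level $s\to0^+$ (equivalently, since the violation depends only on $\|\mu\|/s$, as $\|\mu\|/s\to\infty$). -/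

import Mathlib

open MeasureTheory ProbabilityTheory Filter Topology

noncomputable section

namespace FairSVM

/-- The feature space: the plane with its Euclidean norm. -/
abbrev Plane : Type := EuclideanSpace ℝ (Fin 2)

/-- The mean `y μ + y a ψ` of the group with label `y = ±1` and protected attribute `a = ±1`.
The attribute `a = 1` is the majority and `a = -1` the minority. -/
def groupMean (μ ψ : Plane) (y a : ℤˣ) : Plane :=
  ((y : ℤ) : ℝ) • μ + (((y : ℤ) : ℝ) * ((a : ℤ) : ℝ)) • ψ

/-- The class-conditional law of the features of the group `(y, a)` in the four-Gaussian mixture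
model: the isotropic Gaussian `N(y μ + y a ψ, σ² I)`. -/
def groupLaw (μ ψ : Plane) (σ : ℝ) (y a : ℤˣ) : Measure Plane :=
  multivariateGaussian (groupMean μ ψ y a) (σ ^ 2 • (1 : Matrix (Fin 2) (Fin 2) ℝ))

/-- The geometric margin `min_i ℓ_i (⟨w, x_i⟩ + b)` of the pair `(w, b)`, `‖w‖ = 1`, on a finite
nonempty labelled sample `(x_i, ℓ_i)`. It is negative when the sample is not separated. -/
def margin {ι : Type*} (x : ι → Plane) (l : ι → ℤˣ) (w : Plane) (b : ℝ) : ℝ :=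
  ⨅ i, ((l i : ℤ) : ℝ) * (inner ℝ w (x i) + b)

/-- `(w, b)` is an SVM (maximum margin) solution for the labelled sample `(x_i, ℓ_i)`: among all
unit normals and all offsets it has the largest geometric margin. -/
def IsSVMSolution {ι : Type*} (x : ι → Plane) (l : ι → ℤˣ) (w : Plane) (b : ℝ) : Prop :=
  ‖w‖ = 1 ∧ ∀ (w' : Plane) (b' : ℝ), ‖w'‖ = 1 → margin x l w' b' ≤ margin x l w b

/-- Positions in a training set that has `n y a` points from each group `(y, a)`. -/
abbrev TrainIdx (n : ℤˣ → ℤˣ → ℕ) : Type := (g : ℤˣ × ℤˣ) × Fin (n g.1 g.2)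

/-- The training points: the first `n y a` entries of the sequence `x y a` of each group. -/
def trainPoint (n : ℤˣ → ℤˣ → ℕ) (x : ℤˣ → ℤˣ → ℕ → Plane) : TrainIdx n → Plane :=
  fun j => x j.1.1 j.1.2 j.2

/-- The labels used in training, read off an assignment `L y a i` of a label to the `i`-th point of
the group `(y, a)`. -/
def trainLabel (n : ℤˣ → ℤˣ → ℕ) (L : ℤˣ → ℤˣ → ℕ → ℤˣ) : TrainIdx n → ℤˣ :=
  fun j => L j.1.1 j.1.2 j.2

/-- An assignment of training labels that leaves the majority labels unchanged and is arbitrary on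
the minority. -/
def IsMinorityRelabeling (L : ℤˣ → ℤˣ → ℕ → ℤˣ) : Prop :=
  ∀ (y : ℤˣ) (i : ℕ), L y 1 i = y

/-- `P[h(x) = 1 | a, y]` for the linear classifier `h` that predicts `1` where `⟨w, x⟩ + b > 0`. -/
def positiveRate (μ ψ : Plane) (σ : ℝ) (w : Plane) (b : ℝ) (y a : ℤˣ) : ℝ :=
  (groupLaw μ ψ σ y a).real {x | 0 < inner ℝ w x + b}

/-- The equalized-odds violation
`(1/2) ∑_z |P[h(x) = 1 | a = 1, y = z] - P[h(x) = 1 | a = -1, y = z]|`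
of the linear classifier `(w, b)` in the four-Gaussian mixture model. -/
def eqOd (μ ψ : Plane) (σ : ℝ) (w : Plane) (b : ℝ) : ℝ :=
  (1 / 2) * ∑ z : ℤˣ, |positiveRate μ ψ σ w b z 1 - positiveRate μ ψ σ w b z (-1)|

/-- The spurious direction: the unit vector proportional to `μ + ψ`. -/
def spuriousDirection (μ ψ : Plane) : Plane := ‖μ + ψ‖⁻¹ • (μ + ψ)

end FairSVM

end

/-! The convex hull of `N` independent standard Gaussian points in the plane is, up to an additive
`o(1)`, the disc of radius `√(2 log N)`. So the majority with label `y` acts as a disc about `y(μ +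
ψ)` of radius `R_y = σ√(2 log p_y)`, and bounded class ratios make `R_1 - R_{-1}` tend to zero.

Upper bound (`eventually_forall_margin_le`): the extreme majority point in direction `-y w` forces
margin `≤ ⟨w, μ + ψ⟩ + y b - R_y + o(1)`, uniformly in `w`, `b` and the relabeling. Lower bound
(`eventually_le_margin_spuriousDirection`): the pair `(w_spu, 0)` achieves `‖μ + ψ‖ - R_y - o(1)`.
There the minority is harmless under any labels, since its projections are at most `|⟨w_spu, μ -
ψ⟩|` plus its own smaller radius, and the assumed gap `2 max(‖μ‖, ‖ψ‖)` covers `‖μ + ψ‖ + |⟨w_spu, μ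
- ψ⟩|`.

For an optimal pair the radii cancel and `⟨w, μ + ψ⟩ ± b ≥ ‖μ + ψ‖ - o(1)` for both signs. With
Cauchy-Schwarz this gives `⟨w, μ + ψ⟩ → ‖μ + ψ‖` and `b → 0`. The violation is a continuous function
of `(w, b)` through the normal cdf. -/

namespace FairSVM

/-! ### Gaussian estimates in dimensions one and two. -/

open scoped MatrixOrder in
lemma groupLaw_eq_map (μ ψ : Plane) {σ : ℝ} (hσ : 0 < σ) (y a : ℤˣ) :
    groupLaw μ ψ σ y a =
      (stdGaussian Plane).map (fun x => groupMean μ ψ y a + σ • x) := by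
  have h : CFC.sqrt (σ ^ 2 • (1 : Matrix (Fin 2) (Fin 2) ℝ)) = σ • 1 := by
    have h0 : (0 : Matrix (Fin 2) (Fin 2) ℝ) ≤ σ • 1 :=
      (Matrix.PosSemidef.one.smul hσ.le).nonneg
    refine CFC.sqrt_unique ?_ h0
    rw [smul_mul_smul_comm, one_mul, sq]
  rw [groupLaw, multivariateGaussian, h]
  simp

lemma stdGaussian_map_inner {w : Plane} (hw : ‖w‖ = 1) :
    (stdGaussian Plane).map (fun x => inner ℝ w x) = gaussianReal 0 1 := by
  have h := IsGaussian.map_eq_gaussianReal (μ := stdGaussian Plane) (innerSL ℝ w)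
  rw [variance_dual_stdGaussian, integral_strongDual_stdGaussian] at h
  simpa [hw] using h

/-- Interval length times the least value of the density on it. -/
lemma gaussianReal_real_Icc_ge (a : ℝ) {δ : ℝ} (hδ : 0 ≤ δ) :
    2 * δ * ((√(2 * Real.pi))⁻¹ * Real.exp (-(|a| + δ) ^ 2 / 2)) ≤
      (gaussianReal 0 1).real (Set.Icc (a - δ) (a + δ)) := by
  rw [measureReal_def, gaussianReal_apply_eq_integral 0 one_ne_zero, ENNReal.toReal_ofReal
    (integral_nonneg fun x => gaussianPDFReal_nonneg _ _ _)]
  have hint := (integrable_gaussianPDFReal 0 1).integrableOn (s := Set.Icc (a - δ) (a + δ))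
  have hle : ∀ x ∈ Set.Icc (a - δ) (a + δ),
      (√(2 * Real.pi))⁻¹ * Real.exp (-(|a| + δ) ^ 2 / 2) ≤ gaussianPDFReal 0 1 x := by
    intro x hx
    have hx' : |x| ≤ |a| + δ := by
      have : |x - a| ≤ δ := abs_le.2 ⟨by linarith [hx.1], by linarith [hx.2]⟩
      have := abs_sub_abs_le_abs_sub x a
      linarith
    have hsq : x ^ 2 ≤ (|a| + δ) ^ 2 := by
      rw [← sq_abs x]; gcongr
    simp only [gaussianPDFReal, NNReal.coe_one, mul_one, sub_zero]
    gcongr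
  have := setIntegral_mono_on (μ := volume) (integrableOn_const (by simp)) hint
    measurableSet_Icc hle
  rw [setIntegral_const, Real.volume_real_Icc_of_le (by linarith), smul_eq_mul] at this
  have e : a + δ - (a - δ) = 2 * δ := by ring
  rwa [e] at this

/-- The ball contains a square of half-side `δ`, whose mass factors into two interval masses. What
matters is that the exponent loses only a term linear in `‖u‖` beyond `‖u‖² / 2`. -/
lemma stdGaussian_real_closedBall_ge (u : Plane) {δ : ℝ} (hδ : 0 ≤ δ) :
    (2 * δ ^ 2 / Real.pi) * Real.exp (-(‖u‖ ^ 2 / 2 + 2 * δ * ‖u‖ + δ ^ 2)) ≤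
      (stdGaussian Plane).real (Metric.closedBall u (2 * δ)) := by
  have hbox : (stdGaussian Plane).real
      {x : Plane | ∀ i, x i ∈ Set.Icc (u i - δ) (u i + δ)} =
      ∏ i, (gaussianReal 0 1).real (Set.Icc (u i - δ) (u i + δ)) := by
    rw [measureReal_def, ← map_pi_eq_stdGaussian, Measure.map_apply (by fun_prop)]
    · have : (WithLp.toLp 2 : (Fin 2 → ℝ) → Plane) ⁻¹'
          {x : Plane | ∀ i, x i ∈ Set.Icc (u i - δ) (u i + δ)} =
          Set.univ.pi fun i => Set.Icc (u i - δ) (u i + δ) := by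
        ext x
        rw [Set.mem_univ_pi]
        exact Iff.rfl
      rw [this, Measure.pi_pi, ENNReal.toReal_prod]
      rfl
    · simp only [Set.ofPred_forall]
      exact MeasurableSet.iInter fun i => measurableSet_Icc.preimage (by fun_prop)
  have hsub : {x : Plane | ∀ i, x i ∈ Set.Icc (u i - δ) (u i + δ)} ⊆
      Metric.closedBall u (2 * δ) := by
    intro x hx
    rw [Metric.mem_closedBall, EuclideanSpace.dist_eq]
    refine Real.sqrt_le_iff.2 ⟨by linarith, ?_⟩
    have hi : ∀ i, dist (x i) (u i) ^ 2 ≤ δ ^ 2 := fun i => by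
      have := hx i
      gcongr
      rw [Real.dist_eq]
      exact abs_le.2 ⟨by linarith [this.1], by linarith [this.2]⟩
    rw [Fin.sum_univ_two]
    nlinarith [hi 0, hi 1, sq_nonneg δ]
  refine le_trans ?_ (measureReal_mono hsub)
  rw [hbox, Fin.prod_univ_two]
  refine le_trans ?_ (mul_le_mul (gaussianReal_real_Icc_ge (u 0) hδ)
    (gaussianReal_real_Icc_ge (u 1) hδ) (by positivity) (by positivity))
  have hpi : (√(2 * Real.pi))⁻¹ * (√(2 * Real.pi))⁻¹ = (2 * Real.pi)⁻¹ := by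
    rw [← mul_inv, Real.mul_self_sqrt (by positivity)]
  have hnorm : ‖u‖ ^ 2 = |u 0| ^ 2 + |u 1| ^ 2 := by
    rw [EuclideanSpace.norm_sq_eq, Fin.sum_univ_two]; simp
  have h0 : |u 0| ≤ ‖u‖ := PiLp.norm_apply_le u 0
  have h1 : |u 1| ≤ ‖u‖ := PiLp.norm_apply_le u 1
  calc _ ≤ (2 * δ ^ 2 / Real.pi) *
        Real.exp (-(|u 0| + δ) ^ 2 / 2 + -(|u 1| + δ) ^ 2 / 2) := by
        gcongr
        rw [hnorm]
        nlinarith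
    _ = 4 * δ ^ 2 * ((√(2 * Real.pi))⁻¹ * (√(2 * Real.pi))⁻¹) *
        (Real.exp (-(|u 0| + δ) ^ 2 / 2) * Real.exp (-(|u 1| + δ) ^ 2 / 2)) := by
        rw [hpi, Real.exp_add]; field_simp; ring
    _ = _ := by ring

lemma gaussianReal_real_abs_ge_le {t : ℝ} (ht : 0 ≤ t) :
    (gaussianReal 0 1).real {x | t ≤ |x|} ≤ 2 * Real.exp (-t ^ 2 / 2) := by
  have hint : ∀ s : ℝ, Integrable (fun x => Real.exp (s * id x)) (gaussianReal 0 1) :=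
    fun s => integrable_exp_mul_gaussianReal s
  have hmgf : ∀ s : ℝ, mgf id (gaussianReal 0 1) s = Real.exp (s ^ 2 / 2) := fun s => by
    rw [mgf_id_gaussianReal]; simp
  have h1 := measure_ge_le_exp_mul_mgf t ht (hint t)
  have h2 := measure_le_le_exp_mul_mgf (-t) (neg_nonpos.2 ht) (hint (-t))
  rw [hmgf, ← Real.exp_add] at h1 h2
  have hsub : {x : ℝ | t ≤ |x|} ⊆ {x | t ≤ id x} ∪ {x | id x ≤ -t} := by
    intro x hx
    rcases le_abs'.1 (show t ≤ |x| from hx) with h | h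
    · exact Or.inr h
    · exact Or.inl h
  have h3 := (measureReal_mono hsub (μ := gaussianReal 0 1)).trans (measureReal_union_le _ _)
  have e1 : -t * t + t ^ 2 / 2 = -t ^ 2 / 2 := by ring
  have e2 : - -t * -t + (-t) ^ 2 / 2 = -t ^ 2 / 2 := by ring
  rw [e1] at h1
  rw [e2] at h2
  linarith

/-! ### Borel-Cantelli and the running maximum. -/

lemma ae_eventually_notMem_of_real_le {Ω : Type*} [MeasurableSpace Ω] {P : Measure Ω}
    [IsFiniteMeasure P] {s : ℕ → Set Ω} {g : ℕ → ℝ} (hg : Summable g)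
    (h : ∀ᶠ n in atTop, P.real (s n) ≤ g n) : ∀ᵐ ω ∂P, ∀ᶠ n in atTop, ω ∉ s n := by
  have hs : Summable fun n => P.real (s n) :=
    Summable.of_norm_bounded_eventually_nat hg (by
      filter_upwards [h] with n hn
      rwa [Real.norm_of_nonneg measureReal_nonneg])
  refine ae_eventually_notMem ?_
  have := hs.tsum_ofReal_ne_top
  simpa using this

lemma summable_exp_neg_mul_sqrt {c : ℝ} (hc : 0 < c) :
    Summable fun k : ℕ => Real.exp (-c * √k) := by
  have h := (isLittleO_exp_neg_mul_rpow_atTop hc (-4)).comp_tendsto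
    (Real.tendsto_sqrt_atTop.comp tendsto_natCast_atTop_atTop)
  refine summable_of_isBigO_nat (g := fun k : ℕ => 1 / (k : ℝ) ^ 2)
    (Real.summable_one_div_nat_pow.2 one_lt_two) (h.isBigO.congr_right fun k => ?_)
  have h0 : (0 : ℝ) ≤ √k := Real.sqrt_nonneg _
  simp only [Function.comp_apply]
  rw [Real.rpow_neg h0, show (4 : ℝ) = ((4 : ℕ) : ℝ) by norm_num, Real.rpow_natCast,
    show √(k : ℝ) ^ 4 = (√(k : ℝ) ^ 2) ^ 2 by ring, Real.sq_sqrt k.cast_nonneg, one_div]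

/-- Cauchy condensation: at `n = 2 ^ k` the factor `2 ^ k` cancels the inverse, leaving `exp (-c'
√k)`. -/
lemma summable_inv_mul_exp_neg_mul_sqrt_log {c : ℝ} (hc : 0 < c) :
    Summable fun n : ℕ => (n : ℝ)⁻¹ * Real.exp (-c * √(2 * Real.log n)) := by
  refine (summable_condensed_iff_of_nonneg (fun n => by positivity) ?_).1 ?_
  · intro m n hm hmn
    have hm' : (0 : ℝ) < m := Nat.cast_pos.2 hm
    have hmn' : (m : ℝ) ≤ n := Nat.cast_le.2 hmn
    simp only [neg_mul]
    gcongr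
  · refine (summable_exp_neg_mul_sqrt (c := c * √(2 * Real.log 2)) (by positivity)).congr
      fun k => ?_
    rw [Nat.cast_pow, Nat.cast_ofNat, Real.log_pow, ← mul_assoc,
      mul_inv_cancel₀ (by positivity), one_mul,
      show 2 * ((k : ℝ) * Real.log 2) = (2 * Real.log 2) * k by ring,
      Real.sqrt_mul (show 0 ≤ 2 * Real.log 2 by positivity)]
    ring_nf

/-- Almost sure upper bound on the running maximum of standard Gaussian variables. -/
lemma ae_forall_abs_le_max {Ω : Type*} [MeasurableSpace Ω] {P : Measure Ω}
    [IsProbabilityMeasure P] {Z : ℕ → Ω → ℝ} (hZ : ∀ i, HasLaw (Z i) (gaussianReal 0 1) P)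
    {ε : ℝ} (hε : 0 < ε) :
    ∀ᵐ ω ∂P, ∃ C : ℝ, ∀ N i : ℕ, i < N → |Z i ω| ≤ max C (√(2 * Real.log N) + ε) := by
  -- Each variable is tested against the threshold of its own index, which is monotone; the shift to
  -- `i + 1` matches `i < N`. Since `(√(2 log n) + ε)² / 2 ≥ log n + ε √(2 log n)`, the Chernoff
  -- bounds are summable.
  have hsum := (((summable_inv_mul_exp_neg_mul_sqrt_log hε).comp_injective
    (add_left_injective 1)).mul_left 2)
  have key := ae_eventually_notMem_of_real_le (P := P)
    (s := fun i => {ω | √(2 * Real.log (i + 1 : ℕ)) + ε ≤ |Z i ω|}) hsum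
    (Eventually.of_forall fun i => by
      have hset : P.real {ω | √(2 * Real.log (i + 1 : ℕ)) + ε ≤ |Z i ω|} =
          (gaussianReal 0 1).real {x | √(2 * Real.log (i + 1 : ℕ)) + ε ≤ |x|} := by
        rw [← (hZ i).map_eq, measureReal_def, measureReal_def,
          Measure.map_apply_of_aemeasurable (hZ i).aemeasurable
            (measurableSet_le measurable_const (by fun_prop))]
        rfl
      rw [hset]
      refine (gaussianReal_real_abs_ge_le (by positivity)).trans ?_
      have hpos : (0 : ℝ) < (i + 1 : ℕ) := by positivity
      have hlog : 0 ≤ Real.log (i + 1 : ℕ) := Real.log_natCast_nonneg _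
      simp only [Function.comp_apply]
      rw [← Real.exp_log (inv_pos.2 hpos), Real.log_inv, ← Real.exp_add]
      gcongr
      have := Real.sq_sqrt (show 0 ≤ 2 * Real.log (i + 1 : ℕ) by positivity)
      nlinarith [sq_nonneg ε])
  filter_upwards [key] with ω hω
  obtain ⟨I, hI⟩ := eventually_atTop.1 hω
  -- The constant absorbs the finitely many exceptional indices.
  refine ⟨∑ j ∈ Finset.range I, |Z j ω|, fun N i hi => ?_⟩
  by_cases h : i < I
  · exact le_max_of_le_left (Finset.single_le_sum (f := fun j => |Z j ω|)
      (fun j _ => abs_nonneg _) (Finset.mem_range.2 h))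
  · refine le_max_of_le_right ?_
    have h1 : |Z i ω| < √(2 * Real.log (i + 1 : ℕ)) + ε := not_le.1 (hI i (not_lt.1 h))
    have h2 : (((i + 1 : ℕ)) : ℝ) ≤ N := Nat.cast_le.2 hi
    have h3 : √(2 * Real.log (i + 1 : ℕ)) ≤ √(2 * Real.log N) := by gcongr
    linarith

/-! ### Nets on the circle and the Gaussian convex hull. -/

/-- The point of the unit circle at angle `θ`. -/
noncomputable def circlePoint (θ : ℝ) : Plane := !₂[Real.cos θ, Real.sin θ]

lemma norm_circlePoint (θ : ℝ) : ‖circlePoint θ‖ = 1 := by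
  rw [EuclideanSpace.norm_eq, Fin.sum_univ_two]
  simp [circlePoint]

lemma inner_circlePoint (θ φ : ℝ) :
    inner ℝ (circlePoint θ) (circlePoint φ) = Real.cos (θ - φ) := by
  rw [PiLp.inner_apply, Fin.sum_univ_two, Real.cos_sub]
  simp [circlePoint, mul_comm]

lemma exists_eq_circlePoint {w : Plane} (hw : ‖w‖ = 1) :
    ∃ θ, -Real.pi ≤ θ ∧ θ ≤ Real.pi ∧ w = circlePoint θ := by
  have hz : ‖(⟨w 0, w 1⟩ : ℂ)‖ = 1 := by
    rw [EuclideanSpace.norm_eq, Fin.sum_univ_two] at hw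
    rw [Complex.norm_eq_sqrt_sq_add_sq]
    simpa using hw
  have hz0 : (⟨w 0, w 1⟩ : ℂ) ≠ 0 := by
    intro h; rw [h] at hz; simp at hz
  refine ⟨Complex.arg ⟨w 0, w 1⟩, (Complex.neg_pi_lt_arg _).le, Complex.arg_le_pi _, ?_⟩
  ext i
  fin_cases i
  · simp [circlePoint, Complex.cos_arg hz0, hz]
  · simp [circlePoint, Complex.sin_arg, hz]

/-- The `j`-th of `N + 1` equally spaced angles. -/
noncomputable def netAngle (N j : ℕ) : ℝ := -Real.pi + 2 * Real.pi / N * j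

/-- Rounding the angle down costs at most one step `2π / N`; then `cos d ≥ 1 - d² / 2` and `(2π)² ≤
40`. -/
lemma exists_circlePoint_netAngle {w : Plane} (hw : ‖w‖ = 1) {N : ℕ} (hN : 0 < N) :
    ∃ j ∈ Finset.range (N + 1), 1 - 20 / (N : ℝ) ^ 2 ≤
      inner ℝ w (circlePoint (netAngle N j)) := by
  obtain ⟨θ, h1, h2, rfl⟩ := exists_eq_circlePoint hw
  have hN' : (0 : ℝ) < N := Nat.cast_pos.2 hN
  have hpi := Real.pi_pos
  have hstep : 0 < 2 * Real.pi / N := by positivity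
  set t : ℝ := (θ + Real.pi) / (2 * Real.pi / N) with ht
  have ht0 : 0 ≤ t := div_nonneg (by linarith) hstep.le
  have htN : t ≤ N := by
    rw [ht, div_le_iff₀ hstep]
    field_simp
    linarith
  have hθ : θ = -Real.pi + 2 * Real.pi / N * t := by
    rw [ht, mul_div_cancel₀ _ hstep.ne']; ring
  refine ⟨⌊t⌋₊, Finset.mem_range.2 (Nat.lt_succ_of_le (Nat.floor_le_of_le htN)), ?_⟩
  rw [inner_circlePoint]
  refine le_trans ?_ (Real.one_sub_sq_div_two_le_cos)
  have hd : θ - netAngle N ⌊t⌋₊ = 2 * Real.pi / N * (t - ⌊t⌋₊) := by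
    rw [hθ, netAngle]; ring
  have hf0 : 0 ≤ t - ⌊t⌋₊ := sub_nonneg.2 (Nat.floor_le ht0)
  have hf1 : t - ⌊t⌋₊ ≤ 1 := by linarith [Nat.lt_floor_add_one t]
  have hsq : (θ - netAngle N ⌊t⌋₊) ^ 2 ≤ 40 / (N : ℝ) ^ 2 := by
    rw [hd, mul_pow, div_pow]
    have : (t - ⌊t⌋₊) ^ 2 ≤ 1 := pow_le_one₀ hf0 hf1
    have h40 : (2 * Real.pi) ^ 2 ≤ 40 := by nlinarith [Real.pi_lt_d2]
    calc _ ≤ 40 / (N : ℝ) ^ 2 * 1 := by gcongr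
      _ = _ := mul_one _
  have : (20 : ℝ) / (N : ℝ) ^ 2 = 40 / (N : ℝ) ^ 2 / 2 := by ring
  linarith

lemma real_iInter_preimage_compl_le {Ω : Type*} [MeasurableSpace Ω] {P : Measure Ω}
    [IsProbabilityMeasure P] {E : Type*} [MeasurableSpace E] {ν : Measure E}
    [IsProbabilityMeasure ν] {Z : ℕ → Ω → E} (hZ : ∀ i, HasLaw (Z i) ν P)
    (hindep : iIndepFun Z P) {A : Set E} (hA : MeasurableSet A) (N : ℕ) :
    P.real {ω | ∀ i < N, Z i ω ∉ A} ≤ Real.exp (-(N * ν.real A)) := by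
  have h1 : {ω | ∀ i < N, Z i ω ∉ A} = ⋂ i ∈ Finset.range N, Z i ⁻¹' Aᶜ := by
    ext ω; simp
  have h2 := hindep.measure_inter_preimage_eq_mul (Finset.range N) (sets := fun _ => Aᶜ)
    (fun _ _ => hA.compl)
  have h3 : ∀ i, (P (Z i ⁻¹' Aᶜ)).toReal = 1 - ν.real A := fun i => by
    rw [← Measure.map_apply_of_aemeasurable (hZ i).aemeasurable hA.compl, (hZ i).map_eq,
      ← measureReal_def, probReal_compl_eq_one_sub hA]
  rw [h1, measureReal_def, h2, ENNReal.toReal_prod]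
  simp only [h3, Finset.prod_const, Finset.card_range]
  have h0 : 0 ≤ 1 - ν.real A := sub_nonneg.2 measureReal_le_one
  calc (1 - ν.real A) ^ N ≤ Real.exp (-ν.real A) ^ N := by
        gcongr
        linarith [Real.add_one_le_exp (-ν.real A)]
    _ = _ := by rw [← Real.exp_nat_mul]; ring_nf

lemma tendsto_sqrt_two_log_atTop :
    Tendsto (fun N : ℕ => √(2 * Real.log N)) atTop atTop :=
  Real.tendsto_sqrt_atTop.comp ((Real.tendsto_log_atTop.comp
    tendsto_natCast_atTop_atTop).const_mul_atTop two_pos)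

/-- The factor `3` makes the probability that `N` points all miss a ball at most `N⁻³`, which
remains summable after a union over `N + 1` directions. -/
lemma eventually_three_log_le_mul_stdGaussian_closedBall {ε : ℝ} (hε : 0 < ε) :
    ∀ᶠ N : ℕ in atTop, ∀ v : Plane, ‖v‖ = 1 → 3 * Real.log N ≤
      N * (stdGaussian Plane).real
        (Metric.closedBall ((√(2 * Real.log N) - ε / 2) • v) (2 * (ε / 8))) := by
  set c : ℝ := 2 * (ε / 8) ^ 2 / Real.pi * Real.exp (-(ε ^ 2 / 64)) with hc
  have hcpos : 0 < c := by positivity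
  have hlim : ∀ᶠ R : ℝ in atTop, 3 / 2 * R ^ 2 ≤ c * Real.exp (ε / 4 * R) := by
    have h := (isLittleO_pow_exp_pos_mul_atTop (k := 2) (show 0 < ε / 4 by positivity)).def
      (show 0 < 2 / 3 * c by positivity)
    filter_upwards [h] with R hR
    rw [Real.norm_of_nonneg (by positivity), Real.norm_of_nonneg (by positivity)] at hR
    linarith
  filter_upwards [tendsto_sqrt_two_log_atTop.eventually hlim,
    tendsto_sqrt_two_log_atTop.eventually (eventually_ge_atTop (ε / 2)),
    eventually_gt_atTop 0] with N h1 h2 hN v hv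
  have hN' : (0 : ℝ) < N := Nat.cast_pos.2 hN
  set R := √(2 * Real.log N) with hR
  have hRsq : R ^ 2 = 2 * Real.log N :=
    Real.sq_sqrt (mul_nonneg zero_le_two (Real.log_natCast_nonneg N))
  have hnorm : ‖(R - ε / 2) • v‖ = R - ε / 2 := by
    rw [norm_smul, hv, mul_one, Real.norm_of_nonneg (by linarith)]
  have hball := stdGaussian_real_closedBall_ge ((R - ε / 2) • v)
    (show 0 ≤ ε / 8 by positivity)
  rw [hnorm] at hball
  calc 3 * Real.log N = 3 / 2 * R ^ 2 := by rw [hRsq]; ring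
    _ ≤ c * Real.exp (ε / 4 * R) := h1
    _ = N * (2 * (ε / 8) ^ 2 / Real.pi * Real.exp (-((R - ε / 2) ^ 2 / 2 +
          2 * (ε / 8) * (R - ε / 2) + (ε / 8) ^ 2))) := by
        -- Pulling the centre in by `ε / 2` gains `εR / 2`, while the ball radius costs `εR / 4`.
        -- The term `R² / 2 = log N` cancels the factor `N`, so `exp (εR / 4)` is left to beat `R²`.
        have e : -((R - ε / 2) ^ 2 / 2 + 2 * (ε / 8) * (R - ε / 2) + (ε / 8) ^ 2) =
            -(ε ^ 2 / 64) + ε / 4 * R + -Real.log N := by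
          have : Real.log N = R ^ 2 / 2 := by rw [hRsq]; ring
          rw [this]; ring
        rw [e, Real.exp_add, Real.exp_add, Real.exp_neg (Real.log N), Real.exp_log hN', hc]
        field_simp
    _ ≤ _ := by gcongr

/-- Almost surely, the convex hull of the first `N` standard Gaussian points eventually contains
almost the disc of radius `√(2 log N)`: its support function is at least `√(2 log N) - ε`. -/
lemma ae_eventually_forall_exists_le_inner {Ω : Type*} [MeasurableSpace Ω] {P : Measure Ω}
    [IsProbabilityMeasure P] {Z : ℕ → Ω → Plane}
    (hZ : ∀ i, HasLaw (Z i) (stdGaussian Plane) P) (hindep : iIndepFun Z P)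
    {ε : ℝ} (hε : 0 < ε) :
    ∀ᵐ ω ∂P, ∀ᶠ N : ℕ in atTop, ∀ w : Plane, ‖w‖ = 1 →
      ∃ i < N, √(2 * Real.log N) - ε ≤ inner ℝ w (Z i ω) := by
  let B : ℕ → ℕ → Set Plane := fun N j => Metric.closedBall
    ((√(2 * Real.log N) - ε / 2) • circlePoint (netAngle N j)) (2 * (ε / 8))
  have hsum : Summable fun N : ℕ => 2 * (1 / (N : ℝ) ^ 2) :=
    (Real.summable_one_div_nat_pow.2 one_lt_two).mul_left 2
  have key := ae_eventually_notMem_of_real_le (P := P)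
    (s := fun N => ⋃ j ∈ Finset.range (N + 1), {ω | ∀ i < N, Z i ω ∉ B N j}) hsum (by
      filter_upwards [eventually_three_log_le_mul_stdGaussian_closedBall hε,
        eventually_gt_atTop 0] with N hN hpos
      have hN' : (1 : ℝ) ≤ N := Nat.one_le_cast.2 hpos
      have hj : ∀ j ∈ Finset.range (N + 1), P.real {ω | ∀ i < N, Z i ω ∉ B N j} ≤
          ((N : ℝ) ^ 3)⁻¹ := fun j _ => by
        refine (real_iInter_preimage_compl_le hZ hindep
          Metric.isClosed_closedBall.measurableSet N).trans ?_
        rw [← Real.exp_log (show 0 < ((N : ℝ) ^ 3)⁻¹ by positivity), Real.log_inv, Real.log_pow]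
        exact Real.exp_le_exp.2 (neg_le_neg (hN _ (norm_circlePoint _)))
      refine (measureReal_biUnion_finset_le _ _).trans ((Finset.sum_le_sum hj).trans ?_)
      rw [Finset.sum_const, Finset.card_range, nsmul_eq_mul, Nat.cast_add_one]
      calc ((N : ℝ) + 1) * ((N : ℝ) ^ 3)⁻¹ ≤ (2 * N) * ((N : ℝ) ^ 3)⁻¹ := by
            gcongr; linarith
        _ = _ := by field_simp)
  have hsmall : ∀ᶠ N : ℕ in atTop, 20 / (N : ℝ) ≤ ε / 4 :=
    (tendsto_const_div_atTop_nhds_zero_nat 20).eventually_le_const (by positivity)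
  filter_upwards [key] with ω hω
  filter_upwards [hω, hsmall, eventually_gt_atTop 0,
    tendsto_sqrt_two_log_atTop.eventually (eventually_ge_atTop (ε / 2))] with N hN hs hpos hR w hw
  have hN' : (1 : ℝ) ≤ N := Nat.one_le_cast.2 hpos
  -- The budget `ε` is spent as `ε / 2` for the shifted centre, `ε / 4` for the ball radius and `ε /
  -- 4` for the net. The net error is multiplied by `R ≤ N`, so the net is refined with `N`.
  obtain ⟨j, hj, hjw⟩ := exists_circlePoint_netAngle hw hpos
  have hmem : ∃ i < N, Z i ω ∈ B N j := by
    by_contra hcon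
    push Not at hcon
    exact hN (Set.mem_biUnion hj hcon)
  obtain ⟨i, hi, hiB⟩ := hmem
  refine ⟨i, hi, ?_⟩
  set R := √(2 * Real.log N) with hRdef
  set v := circlePoint (netAngle N j)
  have hRN : R ≤ N := by
    refine Real.sqrt_le_iff.2 ⟨by positivity, ?_⟩
    nlinarith [Real.log_le_sub_one_of_pos (show (0 : ℝ) < N by positivity)]
  have hdist : ‖Z i ω - (R - ε / 2) • v‖ ≤ 2 * (ε / 8) := by
    rw [← dist_eq_norm]; exact hiB
  have hcs := abs_real_inner_le_norm w (Z i ω - (R - ε / 2) • v)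
  rw [hw, one_mul] at hcs
  have h1 := (abs_le.1 (hcs.trans hdist)).1
  rw [inner_sub_right, real_inner_smul_right] at h1
  have h2 : (R - ε / 2) * (1 - 20 / (N : ℝ) ^ 2) ≤ (R - ε / 2) * inner ℝ w v :=
    mul_le_mul_of_nonneg_left hjw (by linarith)
  have h3 : (R - ε / 2) * (20 / (N : ℝ) ^ 2) ≤ ε / 4 := by
    refine le_trans ?_ hs
    calc (R - ε / 2) * (20 / (N : ℝ) ^ 2) ≤ N * (20 / (N : ℝ) ^ 2) := by
          gcongr; linarith
      _ = _ := by field_simp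
  linarith

/-! ### Existence of maximum margin solutions. -/

section Margin

variable {ι : Type*} {x : ι → Plane} {l : ι → ℤˣ}

lemma margin_le [Finite ι] (w : Plane) (b : ℝ) (i : ι) :
    margin x l w b ≤ ((l i : ℤ) : ℝ) * (inner ℝ w (x i) + b) :=
  ciInf_le (Set.finite_range _).bddBelow i

lemma le_margin [Nonempty ι] {w : Plane} {b t : ℝ}
    (h : ∀ i, t ≤ ((l i : ℤ) : ℝ) * (inner ℝ w (x i) + b)) : t ≤ margin x l w b :=
  le_ciInf h

lemma continuous_margin [Finite ι] [Nonempty ι] :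
    Continuous fun p : Plane × ℝ => margin x l p.1 p.2 := by
  have := Fintype.ofFinite ι
  simp only [margin, ← Finset.inf'_univ_eq_ciInf]
  exact Continuous.finset_inf'_apply _ fun i _ => by fun_prop

/-- One point of each label makes the margin at most `K - |b|`, so the search reduces to a compact
set of pairs. -/
lemma exists_isSVMSolution [Finite ι] {i j : ι} (hi : l i = 1) (hj : l j = -1) :
    ∃ w b, IsSVMSolution x l w b := by
  have : Nonempty ι := ⟨i⟩
  obtain ⟨w₀, hw₀⟩ := exists_norm_eq Plane zero_le_one
  set K : ℝ := ‖x i‖ + ‖x j‖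
  have hK : ∀ w b, ‖w‖ = 1 → margin x l w b ≤ K - |b| := by
    intro w b hw
    have h1 := margin_le (x := x) (l := l) w b i
    have h2 := margin_le (x := x) (l := l) w b j
    rw [hi, Units.val_one, Int.cast_one, one_mul] at h1
    rw [hj, Units.val_neg, Units.val_one, Int.cast_neg, Int.cast_one] at h2
    have h3 := abs_le.1 (abs_real_inner_le_norm w (x i))
    have h4 := abs_le.1 (abs_real_inner_le_norm w (x j))
    rw [hw, one_mul] at h3 h4
    have := norm_nonneg (x i)
    have := norm_nonneg (x j)
    rcases abs_cases b with ⟨hb, _⟩ | ⟨hb, _⟩ <;> rw [hb] <;> linarith [h3.2, h4.1]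
  obtain ⟨B, hB0, hB⟩ : ∃ B, 0 ≤ B ∧ K - margin x l w₀ 0 ≤ B := ⟨_, abs_nonneg _, le_abs_self _⟩
  have hcomp : IsCompact (Metric.sphere (0 : Plane) 1 ×ˢ Set.Icc (-B) B) :=
    (isCompact_sphere 0 1).prod isCompact_Icc
  have hmem : ∀ w b, ‖w‖ = 1 → |b| ≤ B →
      (w, b) ∈ Metric.sphere (0 : Plane) 1 ×ˢ Set.Icc (-B) B := fun w b hw hb =>
    Set.mk_mem_prod (mem_sphere_zero_iff_norm.2 hw) (abs_le.1 hb)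
  have hmem₀ := hmem w₀ 0 hw₀ (by simpa using hB0)
  obtain ⟨⟨w, b⟩, hwb, hmax⟩ :=
    hcomp.exists_isMaxOn ⟨_, hmem₀⟩ (continuous_margin (x := x) (l := l)).continuousOn
  rw [isMaxOn_iff] at hmax
  dsimp only at hmax
  have hmax' : ∀ w' b', ‖w'‖ = 1 → |b'| ≤ B → margin x l w' b' ≤ margin x l w b :=
    fun w' b' hw' hb' => hmax (w', b') (hmem w' b' hw' hb')
  refine ⟨w, b, mem_sphere_zero_iff_norm.1 hwb.1, fun w' b' hw' => ?_⟩
  by_cases hb' : |b'| ≤ B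
  · exact hmax' w' b' hw' hb'
  · have h1 := hK w' b' hw'
    have h2 := hmax' w₀ 0 hw₀ (by simpa using hB0)
    linarith [not_le.1 hb']

end Margin

/-! ### Geometry of the group means. -/

lemma groupMean_one (μ ψ : Plane) (y : ℤˣ) :
    groupMean μ ψ y 1 = ((y : ℤ) : ℝ) • (μ + ψ) := by
  simp [groupMean, smul_add]

lemma groupMean_neg_one (μ ψ : Plane) (y : ℤˣ) :
    groupMean μ ψ y (-1) = ((y : ℤ) : ℝ) • (μ - ψ) := by
  simp [groupMean, sub_eq_add_neg]

lemma sign_mul_self (y : ℤˣ) : ((y : ℤ) : ℝ) * ((y : ℤ) : ℝ) = 1 := by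
  rcases Int.units_eq_one_or y with rfl | rfl <;> simp

lemma abs_sign (y : ℤˣ) : |((y : ℤ) : ℝ)| = 1 := by
  rcases Int.units_eq_one_or y with rfl | rfl <;> simp

section Geometry

variable {μ ψ : Plane}

lemma norm_add_sq_of_inner_eq_zero (h : inner ℝ μ ψ = 0) :
    ‖μ + ψ‖ ^ 2 = ‖μ‖ ^ 2 + ‖ψ‖ ^ 2 := by
  rw [norm_add_sq_real, h]; ring

lemma norm_add_pos (hμ : μ ≠ 0) (h : inner ℝ μ ψ = 0) : 0 < ‖μ + ψ‖ := by
  have h1 := norm_add_sq_of_inner_eq_zero h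
  have h2 := norm_pos_iff.2 hμ
  by_contra hcon
  have h3 : ‖μ + ψ‖ = 0 := le_antisymm (not_lt.1 hcon) (norm_nonneg _)
  rw [h3] at h1
  nlinarith [sq_nonneg ‖ψ‖]

lemma norm_spuriousDirection (h : 0 < ‖μ + ψ‖) : ‖spuriousDirection μ ψ‖ = 1 := by
  rw [spuriousDirection, norm_smul, norm_inv, norm_norm, inv_mul_cancel₀ h.ne']

lemma inner_spuriousDirection_add (h : 0 < ‖μ + ψ‖) :
    inner ℝ (spuriousDirection μ ψ) (μ + ψ) = ‖μ + ψ‖ := by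
  rw [spuriousDirection, real_inner_smul_left, real_inner_self_eq_norm_sq]
  field_simp

lemma inner_spuriousDirection_sub :
    inner ℝ (spuriousDirection μ ψ) (μ - ψ) = (‖μ‖ ^ 2 - ‖ψ‖ ^ 2) / ‖μ + ψ‖ := by
  rw [spuriousDirection, real_inner_smul_left, inner_add_left, inner_sub_right, inner_sub_right,
    real_inner_self_eq_norm_sq, real_inner_self_eq_norm_sq, real_inner_comm]
  ring

/-- After multiplication by `‖μ + ψ‖` the left side is `2 max(‖μ‖, ‖ψ‖)²`, and orthogonality gives
`max(‖μ‖, ‖ψ‖) ≤ ‖μ + ψ‖`. This is where the constant of the gap hypothesis comes from. -/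
lemma norm_add_add_abs_inner_le (hμ : μ ≠ 0) (h : inner ℝ μ ψ = 0) :
    ‖μ + ψ‖ + |inner ℝ (spuriousDirection μ ψ) (μ - ψ)| ≤ 2 * max ‖μ‖ ‖ψ‖ := by
  have hpos := norm_add_pos hμ h
  have hsq := norm_add_sq_of_inner_eq_zero h
  rw [inner_spuriousDirection_sub, abs_div, abs_of_pos hpos,
    ← mul_le_mul_iff_of_pos_right hpos, add_mul, div_mul_cancel₀ _ hpos.ne', ← sq, hsq]
  have h1 := norm_nonneg μ
  have h2 := norm_nonneg ψ
  have h3 : ‖μ‖ ≤ ‖μ + ψ‖ := abs_le_of_sq_le_sq' (by nlinarith) hpos.le |>.2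
  have h4 : ‖ψ‖ ≤ ‖μ + ψ‖ := abs_le_of_sq_le_sq' (by nlinarith) hpos.le |>.2
  rcases le_total ‖μ‖ ‖ψ‖ with hle | hle
  · rw [max_eq_right hle, abs_of_nonpos (by nlinarith)]
    nlinarith
  · rw [max_eq_left hle, abs_of_nonneg (by nlinarith)]
    nlinarith

/-- Unit vectors aligned with `μ + ψ` in the limit converge to the spurious direction. -/
lemma tendsto_spuriousDirection {w : ℕ → Plane} (h : 0 < ‖μ + ψ‖)
    (hw : ∀ᶠ k in atTop, ‖w k‖ = 1)
    (hlim : Tendsto (fun k => inner ℝ (w k) (μ + ψ)) atTop (𝓝 ‖μ + ψ‖)) :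
    Tendsto w atTop (𝓝 (spuriousDirection μ ψ)) := by
  rw [tendsto_iff_norm_sub_tendsto_zero]
  have h1 : Tendsto (fun k => √(2 - 2 * (‖μ + ψ‖⁻¹ * inner ℝ (w k) (μ + ψ)))) atTop (𝓝 0) := by
    have := (((hlim.const_mul ‖μ + ψ‖⁻¹).const_mul 2).const_sub 2).sqrt
    rwa [inv_mul_cancel₀ h.ne', mul_one, sub_self, Real.sqrt_zero] at this
  refine h1.congr' ?_
  filter_upwards [hw] with k hk
  rw [← Real.sqrt_sq (norm_nonneg (w k - spuriousDirection μ ψ)), norm_sub_sq_real, hk,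
    norm_spuriousDirection h, spuriousDirection, real_inner_smul_right]
  ring_nf

end Geometry

/-! ### Deterministic margin bounds at one stage. -/

section Stage

variable {μ ψ : Plane} {σ : ℝ} {n : ℤˣ → ℤˣ → ℕ} {z : ℤˣ → ℤˣ → ℕ → Plane}
  {L : ℤˣ → ℤˣ → ℕ → ℤˣ}

/-- The sample with standardized noise `z`. -/
noncomputable def noisySample (μ ψ : Plane) (σ : ℝ) (z : ℤˣ → ℤˣ → ℕ → Plane) :
    ℤˣ → ℤˣ → ℕ → Plane :=
  fun y a i => groupMean μ ψ y a + σ • z y a i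

lemma margin_le_of_majority (hσ : 0 < σ) (hL : IsMinorityRelabeling L) {y : ℤˣ} {w : Plane}
    (b : ℝ) {T : ℝ} {i : ℕ} (hi : i < n y 1)
    (hT : T ≤ inner ℝ (-(((y : ℤ) : ℝ) • w)) (z y 1 i)) :
    margin (trainPoint n (noisySample μ ψ σ z)) (trainLabel n L) w b ≤
      inner ℝ w (μ + ψ) + ((y : ℤ) : ℝ) * b - σ * T := by
  refine (margin_le w b (⟨(y, 1), ⟨i, hi⟩⟩ : TrainIdx n)).trans ?_
  simp only [trainLabel, trainPoint, noisySample, hL y i, groupMean_one]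
  rw [inner_add_right, real_inner_smul_right, real_inner_smul_right]
  rw [inner_neg_left, real_inner_smul_left] at hT
  have := mul_le_mul_of_nonneg_left hT hσ.le
  linear_combination this + inner ℝ w (μ + ψ) * sign_mul_self y

lemma le_margin_spuriousDirection (hσ : 0 < σ) (hc : 0 < ‖μ + ψ‖) (hL : IsMinorityRelabeling L)
    (hn : 0 < n 1 1) {s : ℝ}
    (hmaj : ∀ y, ∀ i < n y 1, σ * |inner ℝ (spuriousDirection μ ψ) (z y 1 i)| ≤ s)
    (hmin : ∀ y, ∀ i < n y (-1), ‖μ + ψ‖ + |inner ℝ (spuriousDirection μ ψ) (μ - ψ)| +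
      σ * |inner ℝ (spuriousDirection μ ψ) (z y (-1) i)| ≤ s) :
    ‖μ + ψ‖ - s ≤ margin (trainPoint n (noisySample μ ψ σ z)) (trainLabel n L)
      (spuriousDirection μ ψ) 0 := by
  have : Nonempty (TrainIdx n) := ⟨⟨(1, 1), ⟨0, hn⟩⟩⟩
  refine le_margin ?_
  rintro ⟨⟨y, a⟩, ⟨i, hi⟩⟩
  simp only [trainLabel, trainPoint, noisySample, add_zero]
  rw [inner_add_right, real_inner_smul_right]
  rcases Int.units_eq_one_or a with rfl | rfl
  · rw [hL y i, groupMean_one, real_inner_smul_right, inner_spuriousDirection_add hc]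
    have h1 := hmaj y i hi
    have h2 : |((y : ℤ) : ℝ) * (σ * inner ℝ (spuriousDirection μ ψ) (z y 1 i))| ≤ s := by
      rwa [abs_mul, abs_sign, one_mul, abs_mul, abs_of_pos hσ]
    linear_combination (abs_le.1 h2).1 - ‖μ + ψ‖ * sign_mul_self y
  · rw [groupMean_neg_one, real_inner_smul_right]
    have h1 := hmin y i hi
    -- Passing to absolute values makes the bound independent of the minority label.
    refine le_trans ?_ (neg_abs_le _)
    rw [abs_mul, abs_sign, one_mul]
    have h2 := abs_add_le (((y : ℤ) : ℝ) * inner ℝ (spuriousDirection μ ψ) (μ - ψ))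
      (σ * inner ℝ (spuriousDirection μ ψ) (z y (-1) i))
    rw [abs_mul, abs_sign, one_mul, abs_mul, abs_of_pos hσ] at h2
    linarith

end Stage

/-! ### Asymptotics of the margin along the stages. -/

/-- A bounded ratio shifts the logarithm by a constant, which the square root turns into a vanishing
error. -/
lemma sqrt_two_log_le_of_ratio {p q : ℕ} {r : ℝ} (hr : 0 < r) (hp : 0 < p) (hq : 1 < q)
    (h : r * p ≤ q) :
    √(2 * Real.log p) ≤ √(2 * Real.log q) + |Real.log r| / √(2 * Real.log q) := by
  have hp' : (0 : ℝ) < p := Nat.cast_pos.2 hp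
  have hq' : 0 < √(2 * Real.log q) :=
    Real.sqrt_pos.2 (mul_pos two_pos (Real.log_pos (Nat.one_lt_cast.2 hq)))
  have h1 : Real.log r + Real.log p ≤ Real.log q := by
    rw [← Real.log_mul hr.ne' hp'.ne']
    exact Real.log_le_log (by positivity) h
  have h2 := Real.sq_sqrt (Real.sqrt_pos.1 hq').le
  refine Real.sqrt_le_iff.2 ⟨by positivity, ?_⟩
  rw [add_sq, h2, mul_assoc 2 √(2 * Real.log q), mul_div_cancel₀ _ hq'.ne']
  nlinarith [neg_abs_le (Real.log r), sq_nonneg (|Real.log r| / √(2 * Real.log q))]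

section Limit

variable {μ ψ : Plane} {σ : ℝ} {n : ℕ → ℤˣ → ℤˣ → ℕ}

lemma tendsto_sqrt_two_log_majority (hmaj : ∀ y : ℤˣ, Tendsto (fun k => n k y 1) atTop atTop)
    (y : ℤˣ) : Tendsto (fun k => √(2 * Real.log (n k y 1))) atTop atTop :=
  tendsto_sqrt_two_log_atTop.comp (hmaj y)

lemma eventually_sqrt_two_log_le (hmaj : ∀ y : ℤˣ, Tendsto (fun k => n k y 1) atTop atTop)
    (hbal : ∃ r : ℝ, 0 < r ∧ ∀ y : ℤˣ, ∀ᶠ k in atTop, r * (n k y 1 : ℝ) ≤ (n k (-y) 1 : ℝ))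
    {ε : ℝ} (hε : 0 < ε) (y y' : ℤˣ) :
    ∀ᶠ k in atTop, √(2 * Real.log (n k y 1)) ≤ √(2 * Real.log (n k y' 1)) + ε := by
  obtain ⟨r, hr, hbal⟩ := hbal
  by_cases hyy : y' = y
  · exact Eventually.of_forall fun k => by rw [hyy]; linarith
  obtain rfl : y' = -y := by
    rcases Int.units_eq_one_or y with rfl | rfl <;>
      rcases Int.units_eq_one_or y' with rfl | rfl <;> simp_all
  have h0 := ((tendsto_sqrt_two_log_majority hmaj (-y)).const_div_atTop
    |Real.log r|).eventually_le_const hε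
  filter_upwards [hbal y, (hmaj y).eventually_gt_atTop 0, (hmaj (-y)).eventually_gt_atTop 1, h0]
    with k h1 h2 h3 h4
  have := sqrt_two_log_le_of_ratio hr h2 h3 h1
  linarith

variable {z : ℤˣ → ℤˣ → ℕ → Plane}

/-- The stage is chosen before `L`, `w` and `b`, so relabelings and solutions may depend on the
sample and on `k`. -/
lemma eventually_forall_margin_le (hσ : 0 < σ)
    (hmaj : ∀ y : ℤˣ, Tendsto (fun k => n k y 1) atTop atTop)
    (hlow : ∀ y : ℤˣ, ∀ ε > 0, ∀ᶠ N : ℕ in atTop, ∀ w : Plane, ‖w‖ = 1 →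
      ∃ i < N, √(2 * Real.log N) - ε ≤ inner ℝ w (z y 1 i))
    {ε : ℝ} (hε : 0 < ε) (y : ℤˣ) :
    ∀ᶠ k in atTop, ∀ L, IsMinorityRelabeling L → ∀ (w : Plane) (b : ℝ), ‖w‖ = 1 →
      margin (trainPoint (n k) (noisySample μ ψ σ z)) (trainLabel (n k) L) w b ≤
        inner ℝ w (μ + ψ) + ((y : ℤ) : ℝ) * b - σ * √(2 * Real.log (n k y 1)) + ε := by
  filter_upwards [(hmaj y).eventually (hlow y (ε / σ) (by positivity))] with k hk L hL w b hw
  obtain ⟨i, hi, hT⟩ := hk (-(((y : ℤ) : ℝ) • w)) (by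
    rw [norm_neg, norm_smul, Real.norm_eq_abs, abs_sign, hw, one_mul])
  have := margin_le_of_majority (μ := μ) (ψ := ψ) hσ hL b hi hT
  rw [mul_sub, mul_div_cancel₀ _ hσ.ne'] at this
  linarith

lemma eventually_le_margin_spuriousDirection (hμ : μ ≠ 0) (hμψ : inner ℝ μ ψ = 0) (hσ : 0 < σ)
    (hmaj : ∀ y : ℤˣ, Tendsto (fun k => n k y 1) atTop atTop)
    (hbal : ∃ r : ℝ, 0 < r ∧ ∀ y : ℤˣ, ∀ᶠ k in atTop, r * (n k y 1 : ℝ) ≤ (n k (-y) 1 : ℝ))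
    (hgap : ∀ (y y' : ℤˣ) (ε : ℝ), 0 < ε → ∀ᶠ k in atTop,
      2 * max ‖μ‖ ‖ψ‖ - ε ≤
        σ * √(2 * Real.log (n k y 1)) - σ * √(2 * Real.log (n k y' (-1))))
    (hup : ∀ y a : ℤˣ, ∀ ε > 0, ∃ C, ∀ N i : ℕ, i < N →
      |inner ℝ (spuriousDirection μ ψ) (z y a i)| ≤ max C (√(2 * Real.log N) + ε))
    {ε : ℝ} (hε : 0 < ε) (y : ℤˣ) :
    ∀ᶠ k in atTop, ∀ L, IsMinorityRelabeling L →
      ‖μ + ψ‖ - σ * √(2 * Real.log (n k y 1)) - ε ≤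
        margin (trainPoint (n k) (noisySample μ ψ σ z)) (trainLabel (n k) L)
          (spuriousDirection μ ψ) 0 := by
  have hc := norm_add_pos hμ hμψ
  have hgeo := norm_add_add_abs_inner_le hμ hμψ
  have hS := tendsto_sqrt_two_log_majority hmaj y
  have hε' : 0 < ε / 2 / σ := by positivity
  have hA : ∀ y', ∀ᶠ k in atTop, ∀ i < n k y' 1,
      σ * |inner ℝ (spuriousDirection μ ψ) (z y' 1 i)| ≤
        σ * √(2 * Real.log (n k y 1)) + ε := by
    intro y'
    obtain ⟨C, hC⟩ := hup y' 1 (ε / 2 / σ) hε'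
    filter_upwards [eventually_sqrt_two_log_le hmaj hbal hε' y' y, hS.eventually_ge_atTop C]
      with k h1 h2 i hi
    have h3 : |inner ℝ (spuriousDirection μ ψ) (z y' 1 i)| ≤
        √(2 * Real.log (n k y 1)) + ε / 2 / σ + ε / 2 / σ :=
      (hC _ i hi).trans (max_le (by linarith) (by linarith))
    have h4 := mul_le_mul_of_nonneg_left h3 hσ.le
    rw [mul_add, mul_add, mul_div_cancel₀ _ hσ.ne'] at h4
    linarith
  have hB : ∀ y', ∀ᶠ k in atTop, ∀ i < n k y' (-1),
      ‖μ + ψ‖ + |inner ℝ (spuriousDirection μ ψ) (μ - ψ)| +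
        σ * |inner ℝ (spuriousDirection μ ψ) (z y' (-1) i)| ≤
        σ * √(2 * Real.log (n k y 1)) + ε := by
    intro y'
    obtain ⟨C, hC⟩ := hup y' (-1) (ε / 2 / σ) hε'
    -- The gap handles a growing minority radius; when `C` dominates the maximum, as for a bounded
    -- minority, divergence of the majority radius suffices.
    filter_upwards [hgap y y' (ε / 2) (by positivity),
      hS.eventually_ge_atTop (C + 2 * max ‖μ‖ ‖ψ‖ / σ)] with k h1 h2 i hi
    have h3 : |inner ℝ (spuriousDirection μ ψ) (z y' (-1) i)| ≤
        √(2 * Real.log (n k y 1)) + ε / σ - 2 * max ‖μ‖ ‖ψ‖ / σ := by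
      refine (hC _ i hi).trans (max_le ?_ ?_)
      · have : 0 < ε / σ := by positivity
        linarith
      · rw [← mul_le_mul_iff_of_pos_left hσ]
        have e1 : σ * (ε / 2 / σ) = ε / 2 := by field_simp
        have e2 : σ * (ε / σ) = ε := by field_simp
        have e3 : σ * (2 * max ‖μ‖ ‖ψ‖ / σ) = 2 * max ‖μ‖ ‖ψ‖ := by field_simp
        rw [mul_add, mul_sub, mul_add, e1, e2, e3]
        linarith
    have h4 := mul_le_mul_of_nonneg_left h3 hσ.le
    rw [mul_sub, mul_add, mul_div_cancel₀ _ hσ.ne', mul_div_cancel₀ _ hσ.ne'] at h4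
    linarith
  filter_upwards [eventually_all.2 hA, eventually_all.2 hB, (hmaj 1).eventually_gt_atTop 0]
    with k h1 h2 h3 L hL
  have := le_margin_spuriousDirection (z := z) hσ hc hL h3 h1 h2
  linarith

lemma eventually_exists_isSVMSolution
    (hmaj : ∀ y : ℤˣ, Tendsto (fun k => n k y 1) atTop atTop) (x : ℤˣ → ℤˣ → ℕ → Plane) :
    ∀ᶠ k in atTop, ∀ L, IsMinorityRelabeling L →
      ∃ w b, IsSVMSolution (trainPoint (n k) x) (trainLabel (n k) L) w b := by
  filter_upwards [(hmaj 1).eventually_gt_atTop 0, (hmaj (-1)).eventually_gt_atTop 0]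
    with k h1 h2 L hL
  exact exists_isSVMSolution (i := (⟨(1, 1), ⟨0, h1⟩⟩ : TrainIdx (n k)))
    (j := (⟨(-1, 1), ⟨0, h2⟩⟩ : TrainIdx (n k))) (hL 1 0) (hL (-1) 0)

/-- Convergence of the maximum margin solutions, given the extremal behaviour of the noise. -/
theorem tendsto_svmSolution (hμ : μ ≠ 0) (hμψ : inner ℝ μ ψ = 0) (hσ : 0 < σ)
    (hmaj : ∀ y : ℤˣ, Tendsto (fun k => n k y 1) atTop atTop)
    (hbal : ∃ r : ℝ, 0 < r ∧ ∀ y : ℤˣ, ∀ᶠ k in atTop, r * (n k y 1 : ℝ) ≤ (n k (-y) 1 : ℝ))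
    (hgap : ∀ (y y' : ℤˣ) (ε : ℝ), 0 < ε → ∀ᶠ k in atTop,
      2 * max ‖μ‖ ‖ψ‖ - ε ≤
        σ * √(2 * Real.log (n k y 1)) - σ * √(2 * Real.log (n k y' (-1))))
    (hlow : ∀ y : ℤˣ, ∀ ε > 0, ∀ᶠ N : ℕ in atTop, ∀ w : Plane, ‖w‖ = 1 →
      ∃ i < N, √(2 * Real.log N) - ε ≤ inner ℝ w (z y 1 i))
    (hup : ∀ y a : ℤˣ, ∀ ε > 0, ∃ C, ∀ N i : ℕ, i < N →
      |inner ℝ (spuriousDirection μ ψ) (z y a i)| ≤ max C (√(2 * Real.log N) + ε))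
    {L : ℕ → ℤˣ → ℤˣ → ℕ → ℤˣ} (hL : ∀ k, IsMinorityRelabeling (L k))
    {w : ℕ → Plane} {b : ℕ → ℝ}
    (hsol : ∀ᶠ k in atTop, IsSVMSolution (trainPoint (n k) (noisySample μ ψ σ z))
      (trainLabel (n k) (L k)) (w k) (b k)) :
    Tendsto w atTop (𝓝 (spuriousDirection μ ψ)) ∧ Tendsto b atTop (𝓝 0) := by
  have hc := norm_add_pos hμ hμψ
  have key : ∀ ε > 0, ∀ᶠ k in atTop, inner ℝ (w k) (μ + ψ) ≤ ‖μ + ψ‖ ∧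
      ‖μ + ψ‖ - ε ≤ inner ℝ (w k) (μ + ψ) + b k ∧
      ‖μ + ψ‖ - ε ≤ inner ℝ (w k) (μ + ψ) - b k := by
    intro ε hε
    have hε2 : 0 < ε / 2 := half_pos hε
    have hA := eventually_all.2 fun y =>
      eventually_forall_margin_le (μ := μ) (ψ := ψ) hσ hmaj hlow hε2 y
    have hB := eventually_all.2 fun y =>
      eventually_le_margin_spuriousDirection hμ hμψ hσ hmaj hbal hgap hup hε2 y
    filter_upwards [hA, hB, hsol] with k h1 h2 h3
    -- Both bounds are taken with the same `y`, so the diverging radius cancels.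
    have h4 : ∀ y : ℤˣ, ‖μ + ψ‖ - ε ≤ inner ℝ (w k) (μ + ψ) + ((y : ℤ) : ℝ) * b k := fun y => by
      have := h1 y (L k) (hL k) (w k) (b k) h3.1
      have := h2 y (L k) (hL k)
      have := h3.2 _ 0 (norm_spuriousDirection hc)
      linarith
    refine ⟨?_, by simpa using h4 1, by simpa [← sub_eq_add_neg] using h4 (-1)⟩
    simpa [h3.1] using real_inner_le_norm (w k) (μ + ψ)
  constructor
  · refine tendsto_spuriousDirection hc (hsol.mono fun k hk => hk.1) ?_
    refine Metric.tendsto_nhds.2 fun ε hε => ?_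
    filter_upwards [key (ε / 2) (half_pos hε)] with k hk
    rw [Real.dist_eq, abs_lt]
    constructor <;> linarith [hk.1, hk.2.1, hk.2.2]
  · refine Metric.tendsto_nhds.2 fun ε hε => ?_
    filter_upwards [key (ε / 2) (half_pos hε)] with k hk
    rw [Real.dist_eq, sub_zero, abs_lt]
    constructor <;> linarith [hk.1, hk.2.1, hk.2.2]

end Limit

/-! ### Equalized odds through the normal cdf. -/

/-- Law of a linear functional of a group: the positive rate through the standard normal cdf. -/
lemma positiveRate_eq_cdf (μ ψ : Plane) {σ : ℝ} (hσ : 0 < σ) {w : Plane} (hw : ‖w‖ = 1)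
    (b : ℝ) (y a : ℤˣ) :
    positiveRate μ ψ σ w b y a =
      1 - cdf (gaussianReal 0 1) (-(inner ℝ w (groupMean μ ψ y a) + b) / σ) := by
  have hmeas : MeasurableSet {x : Plane | 0 < inner ℝ w x + b} :=
    measurableSet_lt measurable_const (by fun_prop)
  have hmap : (stdGaussian Plane).real {x | -(inner ℝ w (groupMean μ ψ y a) + b) / σ <
      inner ℝ w x} = (gaussianReal 0 1).real
        (Set.Ioi (-(inner ℝ w (groupMean μ ψ y a) + b) / σ)) := by
    rw [← stdGaussian_map_inner hw, map_measureReal_apply (by fun_prop) measurableSet_Ioi]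
    rfl
  rw [positiveRate, groupLaw_eq_map μ ψ hσ, map_measureReal_apply (by fun_prop) hmeas,
    cdf_eq_real, ← probReal_compl_eq_one_sub measurableSet_Iic, Set.compl_Iic, ← hmap]
  congr 1
  ext x
  change 0 < inner ℝ w (groupMean μ ψ y a + σ • x) + b ↔ _ < inner ℝ w x
  rw [inner_add_right, real_inner_smul_right, div_lt_iff₀ hσ]
  constructor <;> intro h <;> linarith

/-- A jump of the cdf would be an atom. -/
lemma continuous_cdf_gaussianReal : Continuous (cdf (gaussianReal 0 1)) := by
  have := nullSingletonClass_gaussianReal (μ := 0) (v := 1) one_ne_zero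
  refine continuous_iff_continuousAt.2 fun a => ?_
  rw [(monotone_cdf _).continuousAt_iff_leftLim_eq_rightLim, StieltjesFunction.rightLim_eq]
  refine le_antisymm ((monotone_cdf _).leftLim_le le_rfl) ?_
  have h := (cdf (gaussianReal 0 1)).measure_singleton a
  rw [measure_cdf, measure_singleton, eq_comm, ENNReal.ofReal_eq_zero] at h
  linarith

lemma cdf_gaussianReal_neg (t : ℝ) :
    cdf (gaussianReal 0 1) (-t) = 1 - cdf (gaussianReal 0 1) t := by
  have := nullSingletonClass_gaussianReal (μ := 0) (v := 1) one_ne_zero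
  have h : (gaussianReal 0 1).map (fun x => -x) = gaussianReal 0 1 := by
    rw [gaussianReal_map_neg, neg_zero]
  rw [cdf_eq_real, cdf_eq_real, ← probReal_compl_eq_one_sub measurableSet_Iic, Set.compl_Iic,
    measureReal_congr Ioi_ae_eq_Ici]
  conv_lhs => rw [← h]
  rw [map_measureReal_apply measurable_neg measurableSet_Iic]
  congr 1
  ext x
  exact neg_le_neg_iff (a := x) (b := t)

lemma cdf_gaussianReal_zero : cdf (gaussianReal 0 1) 0 = 1 / 2 := by
  have := cdf_gaussianReal_neg 0
  rw [neg_zero] at this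
  linarith

lemma tendsto_eqOd (μ ψ : Plane) {σ : ℝ} (hσ : 0 < σ) {w : ℕ → Plane} {b : ℕ → ℝ} {w₀ : Plane}
    {b₀ : ℝ} (hw : ∀ᶠ k in atTop, ‖w k‖ = 1) (hlim : Tendsto w atTop (𝓝 w₀))
    (hb : Tendsto b atTop (𝓝 b₀)) :
    Tendsto (fun k => eqOd μ ψ σ (w k) (b k)) atTop (𝓝 (eqOd μ ψ σ w₀ b₀)) := by
  have hw₀ : ‖w₀‖ = 1 :=
    tendsto_nhds_unique (hlim.norm) (tendsto_const_nhds.congr' (hw.mono fun k hk => hk.symm))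
  have hrate : ∀ y a, Tendsto (fun k => positiveRate μ ψ σ (w k) (b k) y a) atTop
      (𝓝 (positiveRate μ ψ σ w₀ b₀ y a)) := by
    intro y a
    rw [positiveRate_eq_cdf μ ψ hσ hw₀]
    refine Tendsto.congr' (hw.mono fun k hk => (positiveRate_eq_cdf μ ψ hσ hk _ y a).symm) ?_
    refine ((continuous_cdf_gaussianReal.tendsto _).comp ?_).const_sub 1
    exact ((hlim.inner tendsto_const_nhds).add hb).neg.div_const σ
  exact (tendsto_finsetSum _ fun z _ => ((hrate z 1).sub (hrate z (-1))).abs).const_mul _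

/-- Equal norms make `μ - ψ` orthogonal to the spurious direction, so both minority rates are `1 /
2`; the two majority rates are symmetric about `1 / 2`, so the summands agree. -/
lemma eqOd_spuriousDirection {μ ψ : Plane} (hc : 0 < ‖μ + ψ‖) (h : ‖μ‖ = ‖ψ‖) {s : ℝ}
    (hs : 0 < s) :
    eqOd μ ψ s (spuriousDirection μ ψ) 0 =
      |cdf (gaussianReal 0 1) (‖μ + ψ‖ / s) - 1 / 2| := by
  have hd : inner ℝ (spuriousDirection μ ψ) (μ - ψ) = 0 := by
    rw [inner_spuriousDirection_sub, h]; simp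
  have huniv : (Finset.univ : Finset ℤˣ) = {1, -1} := by decide
  rw [eqOd, huniv, Finset.sum_pair (by decide)]
  simp only [positiveRate_eq_cdf μ ψ hs (norm_spuriousDirection hc), groupMean_one,
    groupMean_neg_one, real_inner_smul_right, hd, inner_spuriousDirection_add hc, add_zero,
    mul_zero, neg_zero, zero_div, cdf_gaussianReal_zero, neg_div, cdf_gaussianReal_neg]
  simp only [Units.val_one, Units.val_neg, Int.cast_one, Int.cast_neg, one_mul, neg_mul, neg_div,
    cdf_gaussianReal_neg]
  rw [show ∀ t : ℝ, 1 - (1 - t) - (1 - 1 / 2) = t - 1 / 2 from fun t => by ring,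
    show ∀ t : ℝ, 1 - (1 - (1 - t)) - (1 - 1 / 2) = -(t - 1 / 2) from fun t => by ring, abs_neg]
  ring

lemma tendsto_eqOd_spuriousDirection {μ ψ : Plane} (hc : 0 < ‖μ + ψ‖) (h : ‖μ‖ = ‖ψ‖) :
    Tendsto (fun s : ℝ => eqOd μ ψ s (spuriousDirection μ ψ) 0) (𝓝[>] 0) (𝓝 (1 / 2)) := by
  have h1 : Tendsto (fun s : ℝ => ‖μ + ψ‖ / s) (𝓝[>] 0) atTop := by
    simpa only [div_eq_mul_inv] using tendsto_inv_nhdsGT_zero.const_mul_atTop hc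
  have h2 := (((tendsto_cdf_atTop (gaussianReal 0 1)).comp h1).sub_const (1 / 2)).abs
  rw [show |(1 : ℝ) - 1 / 2| = 1 / 2 by norm_num] at h2
  refine h2.congr' ?_
  filter_upwards [self_mem_nhdsWithin] with s hs
  exact (eqOd_spuriousDirection hc h hs).symm

/-! ### Standardized noise and almost sure statements. -/

section Noise

variable {Ω : Type*} [MeasurableSpace Ω] {P : Measure Ω}

/-- The standardized noise of a point of the group `(y, a)`. -/
noncomputable def standardize (μ ψ : Plane) (σ : ℝ) (y a : ℤˣ) (x : Plane) : Plane :=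
  σ⁻¹ • (x - groupMean μ ψ y a)

lemma measurable_standardize (μ ψ : Plane) (σ : ℝ) (y a : ℤˣ) :
    Measurable (standardize μ ψ σ y a) := by
  unfold standardize; fun_prop

lemma hasLaw_standardize {μ ψ : Plane} {σ : ℝ} (hσ : 0 < σ) {y a : ℤˣ} {X : Ω → Plane}
    (hX : HasLaw X (groupLaw μ ψ σ y a) P) :
    HasLaw (fun ω => standardize μ ψ σ y a (X ω)) (stdGaussian Plane) P where
  aemeasurable := (measurable_standardize μ ψ σ y a).comp_aemeasurable hX.aemeasurable
  map_eq := by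
    change P.map (standardize μ ψ σ y a ∘ X) = _
    rw [← AEMeasurable.map_map_of_aemeasurable
      (measurable_standardize μ ψ σ y a).aemeasurable hX.aemeasurable, hX.map_eq,
      groupLaw_eq_map μ ψ hσ, Measure.map_map (measurable_standardize μ ψ σ y a) (by fun_prop)]
    have : standardize μ ψ σ y a ∘ (fun x => groupMean μ ψ y a + σ • x) = id := by
      ext1 x
      simp [standardize, smul_smul, inv_mul_cancel₀ hσ.ne']
    rw [this, Measure.map_id]

lemma hasLaw_inner_stdGaussian {Z : Ω → Plane} (hZ : HasLaw Z (stdGaussian Plane) P) {w : Plane}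
    (hw : ‖w‖ = 1) : HasLaw (fun ω => inner ℝ w (Z ω)) (gaussianReal 0 1) P where
  aemeasurable := (show Measurable fun x : Plane => inner ℝ w x by
    fun_prop).comp_aemeasurable hZ.aemeasurable
  map_eq := by
    rw [← stdGaussian_map_inner hw, ← hZ.map_eq,
      AEMeasurable.map_map_of_aemeasurable (by fun_prop) hZ.aemeasurable]
    rfl

/-- Monotonicity reduces uncountably many `ε` to the sequence `1 / (j + 1)`, so one null set serves
them all. -/
lemma ae_forall_pos {p : ℝ → Ω → Prop} (hp : ∀ ε > 0, ∀ᵐ ω ∂P, p ε ω)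
    (hmono : ∀ ε δ ω, ε ≤ δ → p ε ω → p δ ω) : ∀ᵐ ω ∂P, ∀ ε > 0, p ε ω := by
  filter_upwards [ae_all_iff.2 fun j : ℕ => hp (1 / ((j : ℝ) + 1)) (by positivity)] with ω hω ε hε
  obtain ⟨j, hj⟩ := exists_nat_one_div_lt hε
  exact hmono _ _ _ hj.le (hω j)

end Noise

end FairSVM

theorem mainTheorem5
    {Ω : Type*} [MeasurableSpace Ω] (P : Measure Ω) [IsProbabilityMeasure P]
    (μ ψ : FairSVM.Plane) (hμ : μ ≠ 0) (hψ : ψ ≠ 0) (hμψ : inner ℝ μ ψ = 0)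
    (σ : ℝ) (hσ : 0 < σ)
    -- `X y a i` is the `i`-th sample of the group `(y, a)`; all samples are independent.
    (X : ℤˣ → ℤˣ → ℕ → Ω → FairSVM.Plane)
    (hlaw : ∀ (y a : ℤˣ) (i : ℕ), HasLaw (X y a i) (FairSVM.groupLaw μ ψ σ y a) P)
    (hindep : iIndepFun (fun t : ℤˣ × ℤˣ × ℕ => X t.1 t.2.1 t.2.2) P)
    -- `n k y a` is the number of training samples of the group `(y, a)` at stage `k`.
    (n : ℕ → ℤˣ → ℤˣ → ℕ)
    (hmaj : ∀ y : ℤˣ, Tendsto (fun k => n k y 1) atTop atTop)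
    (hbal : ∃ r : ℝ, 0 < r ∧ ∀ y : ℤˣ, ∀ᶠ k in atTop, r * (n k y 1 : ℝ) ≤ (n k (-y) 1 : ℝ))
    (hgap : ∀ (y y' : ℤˣ) (ε : ℝ), 0 < ε → ∀ᶠ k in atTop,
      2 * max ‖μ‖ ‖ψ‖ - ε ≤
        σ * √(2 * Real.log (n k y 1)) - σ * √(2 * Real.log (n k y' (-1)))) :
    (∀ᵐ ω ∂P, ∀ L : ℕ → ℤˣ → ℤˣ → ℕ → ℤˣ, (∀ k, FairSVM.IsMinorityRelabeling (L k)) →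
      (∀ᶠ k in atTop, ∃ (w : FairSVM.Plane) (b : ℝ), FairSVM.IsSVMSolution
        (FairSVM.trainPoint (n k) (fun y a i => X y a i ω))
        (FairSVM.trainLabel (n k) (L k)) w b) ∧
      ∀ (w : ℕ → FairSVM.Plane) (b : ℕ → ℝ),
        (∀ᶠ k in atTop, FairSVM.IsSVMSolution
          (FairSVM.trainPoint (n k) (fun y a i => X y a i ω))
          (FairSVM.trainLabel (n k) (L k)) (w k) (b k)) →
        Tendsto w atTop (𝓝 (FairSVM.spuriousDirection μ ψ)) ∧
        Tendsto b atTop (𝓝 0) ∧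
        Tendsto (fun k => FairSVM.eqOd μ ψ σ (w k) (b k)) atTop
          (𝓝 (FairSVM.eqOd μ ψ σ (FairSVM.spuriousDirection μ ψ) 0))) ∧
    (‖μ‖ = ‖ψ‖ →
      Tendsto (fun s : ℝ => FairSVM.eqOd μ ψ s (FairSVM.spuriousDirection μ ψ) 0)
        (𝓝[>] 0) (𝓝 (1 / 2))) := by
  have hc := FairSVM.norm_add_pos hμ hμψ
  refine ⟨?_, FairSVM.tendsto_eqOd_spuriousDirection hc⟩
  have hZ : ∀ y a i, HasLaw (fun ω => FairSVM.standardize μ ψ σ y a (X y a i ω))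
      (stdGaussian FairSVM.Plane) P := fun y a i => FairSVM.hasLaw_standardize hσ (hlaw y a i)
  have hindepZ : ∀ y, iIndepFun (fun i ω => FairSVM.standardize μ ψ σ y 1 (X y 1 i ω)) P :=
    fun y => (hindep.precomp (g := fun i : ℕ => (y, (1 : ℤˣ), i)) fun i j hij => by
      simpa using hij).comp (fun _ => FairSVM.standardize μ ψ σ y 1)
        fun _ => FairSVM.measurable_standardize μ ψ σ y 1
  have hlow : ∀ᵐ ω ∂P, ∀ y : ℤˣ, ∀ ε > 0, ∀ᶠ N : ℕ in atTop, ∀ w : FairSVM.Plane, ‖w‖ = 1 →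
      ∃ i < N, √(2 * Real.log N) - ε ≤
        inner ℝ w (FairSVM.standardize μ ψ σ y 1 (X y 1 i ω)) := by
    refine ae_all_iff.2 fun y => FairSVM.ae_forall_pos (fun ε hε =>
      FairSVM.ae_eventually_forall_exists_le_inner (hZ y 1) (hindepZ y) hε) ?_
    intro ε δ ω hle h
    filter_upwards [h] with N hN w hw
    obtain ⟨i, hi, h'⟩ := hN w hw
    exact ⟨i, hi, by linarith⟩
  have hup : ∀ᵐ ω ∂P, ∀ y a : ℤˣ, ∀ ε > 0, ∃ C, ∀ N i : ℕ, i < N →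
      |inner ℝ (FairSVM.spuriousDirection μ ψ)
        (FairSVM.standardize μ ψ σ y a (X y a i ω))| ≤ max C (√(2 * Real.log N) + ε) := by
    refine ae_all_iff.2 fun y => ae_all_iff.2 fun a => FairSVM.ae_forall_pos (fun ε hε =>
      FairSVM.ae_forall_abs_le_max (fun i => FairSVM.hasLaw_inner_stdGaussian (hZ y a i)
        (FairSVM.norm_spuriousDirection hc)) hε) ?_
    rintro ε δ ω hle ⟨C, hC⟩
    exact ⟨C, fun N i hi => (hC N i hi).trans (max_le_max le_rfl (by linarith))⟩
  filter_upwards [hlow, hup] with ω h1 h2 L hL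
  have hX : (fun y a i => X y a i ω) = FairSVM.noisySample μ ψ σ
      fun y a i => FairSVM.standardize μ ψ σ y a (X y a i ω) := by
    funext y a i
    rw [FairSVM.noisySample, FairSVM.standardize, smul_inv_smul₀ hσ.ne', add_sub_cancel]
  refine ⟨(FairSVM.eventually_exists_isSVMSolution hmaj _).mono fun k hk => hk _ (hL k),
    fun w b hsol => ?_⟩
  rw [hX] at hsol
  obtain ⟨hw, hb⟩ := FairSVM.tendsto_svmSolution hμ hμψ hσ hmaj hbal hgap h1 h2 hL hsol
  exact ⟨hw, hb, FairSVM.tendsto_eqOd μ ψ hσ (hsol.mono fun k hk => hk.1) hw hb⟩
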